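/- Let $n\ge 1$ and let $A_{-1},A_0,A_1,\dots$ be entrywise nonnegative real $n\times n$ matrices whose series converges to an irreducible row stochastic matrix $A=\sum_{i=-1}^\infty A_i$ (that is, $A\ge 0$ and $Ae=e$, where $e$ is the vector of all ones). Let $v$ be the unique positive vector with $v^TA=v^T$ and $v^Te=1$. Assume that the series $\sum_{i=-1}^\infty iA_i$ converges and that the drift $\eta=v^T\sum_{i=-1}^\infty iA_ie$ satisfies $\eta<0$. Then $I_n-A_0$ is invertible, and the equation $X=\sum_{i=-1}^\infty A_iX^{i+1}$ has a solution $G$ that is entrywise minimal among its entrywise nonnegative solutions. Moreover, for every row stochastic matrix $X_0$, let the sequences $(X_k)_{k\ge0}$ and $(Y_k)_{k\ge0}$ be generated from $X_0$ by \[ (I_n-A_0)\,Y_k=A_{-1}+\sum_{i=1}^\infty A_iX_k^{i+1},\qquad X_{k+1}=Y_k+(I_n-A_0)^{-1}A_1\,(Y_k^2-X_k^2),\qquad k\ge 0. \] Then all the series in this iteration converge, all the matrices $X_k$ and $Y_k$ are row stochastic, and $\lim_{k\to\infty}X_k=G$. -/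

import Mathlib

open Matrix Filter Topology

/- A sequence `A : ℕ → Matrix (Fin n) (Fin n) ℝ` encodes the coefficients `A_{-1}, A_0, A_1, …`:
`A i` is the coefficient with index `i - 1`. -/

/-- The standing assumptions on the coefficients: all of them are entrywise nonnegative, and
their series converges to an irreducible row stochastic matrix. -/
structure IsMG1 {n : ℕ} (A : ℕ → Matrix (Fin n) (Fin n) ℝ) : Prop where
  nonneg : ∀ k i j, 0 ≤ A k i j
  summable : Summable A
  stochastic : (∑' k, A k) ∈ rowStochastic ℝ (Fin n)
  irreducible : (∑' k, A k).IsIrreducible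

/-- `v` is a positive left fixed vector of `S`, normalised to have entries of sum one. -/
def IsPerronVector {n : ℕ} (S : Matrix (Fin n) (Fin n) ℝ) (v : Fin n → ℝ) : Prop :=
  v ᵥ* S = v ∧ v ⬝ᵥ 1 = 1 ∧ ∀ i, 0 < v i

/-- A left fixed vector of a stochastic matrix has a fixed vector of absolute values. -/
theorem abs_vecMul_eq {n : ℕ} {S : Matrix (Fin n) (Fin n) ℝ} (hS : S ∈ rowStochastic ℝ (Fin n))
    {v : Fin n → ℝ} (hv : v ᵥ* S = v) : |v| ᵥ* S = |v| := by
  have hle : ∀ j, |v| j ≤ (|v| ᵥ* S) j := by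
    intro j
    have h1 : v j = ∑ i, v i * S i j := by
      conv_lhs => rw [← hv]
      rfl
    calc |v| j = |∑ i, v i * S i j| := by rw [← h1]; rfl
      _ ≤ ∑ i, |v i * S i j| := Finset.abs_sum_le_sum_abs _ _
      _ = ∑ i, |v| i * S i j :=
        Finset.sum_congr rfl fun i _ => by rw [abs_mul, abs_of_nonneg (hS.1 i j)]; rfl
  have hsum : ∑ j, |v| j = ∑ j, (|v| ᵥ* S) j := by
    have h : (|v| ᵥ* S) ⬝ᵥ 1 = |v| ⬝ᵥ 1 := by rw [← dotProduct_mulVec, hS.2]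
    simpa [dotProduct] using h.symm
  have h := (Finset.sum_eq_sum_iff_of_le (fun j _ => hle j)).1 hsum
  exact funext fun j => (h j (Finset.mem_univ j)).symm

/-- A nonnegative nonzero left fixed vector of an irreducible matrix is positive. -/
theorem pos_of_vecMul_eq {n : ℕ} {S : Matrix (Fin n) (Fin n) ℝ} (hI : S.IsIrreducible)
    {u : Fin n → ℝ} (hu : u ᵥ* S = u) (h0 : ∀ i, 0 ≤ u i) (hne : u ≠ 0) : ∀ i, 0 < u i := by
  intro i
  obtain ⟨j, hj⟩ := Function.ne_iff.1 hne
  obtain ⟨k, -, hk⟩ := (isIrreducible_iff_exists_pow_pos hI.nonneg).1 hI j i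
  have hpow : ∀ m : ℕ, u ᵥ* S ^ m = u := by
    intro m
    induction m with
    | zero => simp
    | succ m ih => rw [pow_succ, ← vecMul_vecMul, ih, hu]
  have hnn : ∀ (m : ℕ) (a b : Fin n), 0 ≤ (S ^ m) a b := by
    intro m
    induction m with
    | zero => intro a b; by_cases h : a = b <;> simp [one_apply, h]
    | succ m ih =>
      intro a b
      rw [pow_succ, mul_apply]
      exact Finset.sum_nonneg fun c _ => mul_nonneg (ih a c) (hI.nonneg c b)
  have hi : u i = ∑ a, u a * (S ^ k) a i := by
    conv_lhs => rw [← hpow k]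
    rfl
  rw [hi]
  refine Finset.sum_pos' (fun a _ => mul_nonneg (h0 a) (hnn k a i)) ⟨j, Finset.mem_univ j, ?_⟩
  exact mul_pos (lt_of_le_of_ne (h0 j) (Ne.symm hj)) hk

/-- An irreducible stochastic matrix of positive size has exactly one Perron vector. -/
theorem existsUnique_isPerronVector {n : ℕ} (hn : 0 < n) {S : Matrix (Fin n) (Fin n) ℝ}
    (hS : S ∈ rowStochastic ℝ (Fin n)) (hI : S.IsIrreducible) : ∃! v, IsPerronVector S v := by
  have : Nonempty (Fin n) := ⟨⟨0, hn⟩⟩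
  have hdet : (S - 1).det = 0 := by
    refine exists_mulVec_eq_zero_iff.1 ⟨1, one_ne_zero, ?_⟩
    rw [sub_mulVec, hS.2, one_mulVec, sub_self]
  obtain ⟨v, hv0, hv⟩ := exists_vecMul_eq_zero_iff.2 hdet
  have hv' : v ᵥ* S = v := by
    rw [vecMul_sub, vecMul_one] at hv
    exact sub_eq_zero.1 hv
  have hpos := pos_of_vecMul_eq hI (abs_vecMul_eq hS hv') (fun i => abs_nonneg (v i))
    (fun h => hv0 (funext fun i => abs_eq_zero.1 (congrFun h i)))
  have hs : 0 < |v| ⬝ᵥ 1 := by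
    simpa [dotProduct] using Finset.sum_pos (fun i _ => hpos i) Finset.univ_nonempty
  refine ⟨(|v| ⬝ᵥ 1)⁻¹ • |v|, ⟨?_, ?_, ?_⟩, ?_⟩
  · rw [smul_vecMul, abs_vecMul_eq hS hv']
  · rw [smul_dotProduct, smul_eq_mul, inv_mul_cancel₀ hs.ne']
  · intro i
    exact mul_pos (inv_pos.2 hs) (hpos i)
  · have huniq : ∀ x y, IsPerronVector S x → IsPerronVector S y → ∀ i, x i ≤ y i := by
      intro x y hx hy
      have hd : (x - y) ᵥ* S = x - y := by rw [sub_vecMul, hx.1, hy.1]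
      have hp : (|x - y| + (x - y)) ᵥ* S = |x - y| + (x - y) := by
        rw [add_vecMul, abs_vecMul_eq hS hd, hd]
      by_cases h0 : |x - y| + (x - y) = 0
      · intro i
        have h1 : |x i - y i| + (x i - y i) = 0 := congrFun h0 i
        linarith [abs_nonneg (x i - y i)]
      · exfalso
        have h2 := pos_of_vecMul_eq hI hp (fun i => by
          have := neg_abs_le (x i - y i)
          change 0 ≤ |x i - y i| + (x i - y i)
          linarith) h0
        have h3 : ∀ i, y i < x i := by
          intro i
          have h4 : 0 < |x i - y i| + (x i - y i) := h2 i
          by_contra h5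
          rw [abs_of_nonpos (by linarith)] at h4
          linarith
        have h6 : ∑ i, y i < ∑ i, x i :=
          Finset.sum_lt_sum_of_nonempty Finset.univ_nonempty fun i _ => h3 i
        have hx1 := hx.2.1
        have hy1 := hy.2.1
        simp only [dotProduct, Pi.one_apply, mul_one] at hx1 hy1
        linarith
    intro y hy
    have hz : IsPerronVector S ((|v| ⬝ᵥ 1)⁻¹ • |v|) := by
      refine ⟨?_, ?_, fun i => mul_pos (inv_pos.2 hs) (hpos i)⟩
      · rw [smul_vecMul, abs_vecMul_eq hS hv']
      · rw [smul_dotProduct, smul_eq_mul, inv_mul_cancel₀ hs.ne']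
    exact funext fun i => le_antisymm (huniq _ _ hy hz i) (huniq _ _ hz hy i)

/-- The Perron vector of `S`, uniquely determined when `S` is irreducible and stochastic
of positive size, by `existsUnique_isPerronVector`. -/
noncomputable def perronVector {n : ℕ} (S : Matrix (Fin n) (Fin n) ℝ) : Fin n → ℝ :=
  Classical.epsilon (IsPerronVector S)

theorem isPerronVector_perronVector {n : ℕ} (hn : 0 < n) {S : Matrix (Fin n) (Fin n) ℝ}
    (hS : S ∈ rowStochastic ℝ (Fin n)) (hI : S.IsIrreducible) :
    IsPerronVector S (perronVector S) :=
  Classical.epsilon_spec (existsUnique_isPerronVector hn hS hI).exists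

/-- The drift `η = vᵀ w`, where `v` is the Perron vector of `∑ A_i` and `w = ∑ i A_i e`
(the coefficient `A i` has index `i - 1`). -/
noncomputable def drift {n : ℕ} (A : ℕ → Matrix (Fin n) (Fin n) ℝ) : ℝ :=
  perronVector (∑' i, A i) ⬝ᵥ ((∑' i : ℕ, ((i : ℝ) - 1) • A i) *ᵥ 1)

/-- The drift condition: the series `∑ i A_i` converges and the drift is negative. -/
def DriftCondition {n : ℕ} (A : ℕ → Matrix (Fin n) (Fin n) ℝ) : Prop :=
  Summable (fun i : ℕ => ((i : ℝ) - 1) • A i) ∧ drift A < 0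

/-- `X` is an entrywise nonnegative solution of `X = A_{-1} + A_0 X + A_1 X² + ⋯`. -/
def IsNonnegSolution {n : ℕ} (A : ℕ → Matrix (Fin n) (Fin n) ℝ)
    (X : Matrix (Fin n) (Fin n) ℝ) : Prop :=
  (∀ i j, 0 ≤ X i j) ∧ HasSum (fun i : ℕ => A i * X ^ i) X

/-- `G` is the entrywise minimal nonnegative solution of the matrix equation. -/
def IsMinimalNonnegSolution {n : ℕ} (A : ℕ → Matrix (Fin n) (Fin n) ℝ)
    (G : Matrix (Fin n) (Fin n) ℝ) : Prop :=
  IsNonnegSolution A G ∧ ∀ Z, IsNonnegSolution A Z → ∀ i j, G i j ≤ Z i j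

/-- The sequences `X`, `Y` are generated by the two-stage iteration
`(I - A_0) Y_k = A_{-1} + ∑_{i ≥ 1} A_i X_k^{i+1}`,
`X_{k+1} = Y_k + (I - A_0)⁻¹ A_1 (Y_k² - X_k²)`. -/
def IsStaircaseIteration {n : ℕ} (A : ℕ → Matrix (Fin n) (Fin n) ℝ)
    (X Y : ℕ → Matrix (Fin n) (Fin n) ℝ) : Prop :=
  ∀ k, (1 - A 1) * Y k = A 0 + ∑' i : ℕ, A (i + 2) * X k ^ (i + 2) ∧
    X (k + 1) = Y k + (1 - A 1)⁻¹ * A 2 * (Y k ^ 2 - X k ^ 2)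

/-! Write `F` for the right-hand side of the equation and `S` for the sum of the coefficients; `A 1`
is the coefficient of index zero. Iterating `F` from zero gives an increasing sequence `T_k` of
substochastic matrices, whose limit `G` is the minimal nonnegative solution
(`IsMG1.exists_tendsto_naturalIter`).

Negative drift makes `G` stochastic (`IsNonnegSolution.mem_rowStochastic`). A Poisson equation for
`S` gives a Lyapunov function `l e + w` on the levels `l`, and a maximum principle bounds `e - G^l
e` by each of its positive multiples.

By irreducibility `1 - A 1` is invertible, and its inverse is nonnegative. In both stages,
multiplying by `1 - A 1` leaves an expression with nonnegative coefficients: for `X_{k+1}` the term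
in `X_k ^ 2` cancels. Hence the iterates stay stochastic, and `T_k ≤ X_k` by induction
(`IsStaircaseIteration.naturalIter_le`). Since `X_k - T_k` is nonnegative with row sums tending to
zero, `X_k` tends to `G`. -/

/-! ### Entrywise nonnegative matrices -/

section Entrywise

variable {n : ℕ}

/-- A nonnegative matrix whose rows have sum at most one. -/
def IsRowSubstochastic (X : Matrix (Fin n) (Fin n) ℝ) : Prop :=
  (∀ i j, 0 ≤ X i j) ∧ ∀ i, (X *ᵥ 1) i ≤ 1

theorem mul_entry_nonneg {X Y : Matrix (Fin n) (Fin n) ℝ} (hX : ∀ i j, 0 ≤ X i j)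
    (hY : ∀ i j, 0 ≤ Y i j) (i j : Fin n) : 0 ≤ (X * Y) i j := by
  rw [mul_apply]
  exact Finset.sum_nonneg fun k _ => mul_nonneg (hX i k) (hY k j)

theorem mul_entry_mono {X X' Y Y' : Matrix (Fin n) (Fin n) ℝ} (hX : ∀ i j, 0 ≤ X i j)
    (hXX : ∀ i j, X i j ≤ X' i j) (hY : ∀ i j, 0 ≤ Y i j) (hYY : ∀ i j, Y i j ≤ Y' i j)
    (i j : Fin n) : (X * Y) i j ≤ (X' * Y') i j := by
  rw [mul_apply, mul_apply]
  exact Finset.sum_le_sum fun k _ =>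
    mul_le_mul (hXX i k) (hYY k j) (hY k j) ((hX i k).trans (hXX i k))

theorem pow_entry_nonneg {X : Matrix (Fin n) (Fin n) ℝ} (hX : ∀ i j, 0 ≤ X i j) (m : ℕ) :
    ∀ i j, 0 ≤ (X ^ m) i j := by
  induction m with
  | zero => intro i j; by_cases h : i = j <;> simp [one_apply, h]
  | succ m ih => rw [pow_succ]; exact mul_entry_nonneg ih hX

theorem pow_entry_mono {X Y : Matrix (Fin n) (Fin n) ℝ} (hX : ∀ i j, 0 ≤ X i j)
    (hXY : ∀ i j, X i j ≤ Y i j) (m : ℕ) : ∀ i j, (X ^ m) i j ≤ (Y ^ m) i j := by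
  induction m with
  | zero => simp
  | succ m ih =>
    rw [pow_succ, pow_succ]
    exact mul_entry_mono (pow_entry_nonneg hX m) ih hX hXY

theorem mulVec_entry_mono {X : Matrix (Fin n) (Fin n) ℝ} (hX : ∀ i j, 0 ≤ X i j)
    {x y : Fin n → ℝ} (h : ∀ i, x i ≤ y i) (i : Fin n) : (X *ᵥ x) i ≤ (X *ᵥ y) i := by
  simp only [mulVec, dotProduct]
  exact Finset.sum_le_sum fun k _ => mul_le_mul_of_nonneg_left (h k) (hX i k)

theorem entry_le_mulVec_one {X : Matrix (Fin n) (Fin n) ℝ} (hX : ∀ i j, 0 ≤ X i j)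
    (i j : Fin n) : X i j ≤ (X *ᵥ 1) i := by
  simpa [mulVec, dotProduct] using
    Finset.single_le_sum (fun k _ => hX i k) (Finset.mem_univ j)

theorem IsRowSubstochastic.pow {X : Matrix (Fin n) (Fin n) ℝ} (hX : IsRowSubstochastic X)
    (m : ℕ) : IsRowSubstochastic (X ^ m) := by
  refine ⟨pow_entry_nonneg hX.1 m, ?_⟩
  induction m with
  | zero => simp
  | succ m ih =>
    intro i
    rw [pow_succ, ← mulVec_mulVec]
    exact (mulVec_entry_mono (pow_entry_nonneg hX.1 m) (y := 1) hX.2 i).trans (ih i)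

theorem isRowSubstochastic_of_mem {X : Matrix (Fin n) (Fin n) ℝ}
    (hX : X ∈ rowStochastic ℝ (Fin n)) : IsRowSubstochastic X :=
  ⟨hX.1, fun i => (congrFun hX.2 i).le⟩

theorem hasSum_entry {f : ℕ → Matrix (Fin n) (Fin n) ℝ} {S : Matrix (Fin n) (Fin n) ℝ}
    (h : HasSum f S) (i j : Fin n) : HasSum (fun k => f k i j) (S i j) :=
  Pi.hasSum.1 (Pi.hasSum.1 h i) j

theorem summable_of_entry {f : ℕ → Matrix (Fin n) (Fin n) ℝ}
    (h : ∀ i j, Summable fun k => f k i j) : Summable f :=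
  Pi.summable.2 fun i => Pi.summable.2 fun j => h i j

theorem hasSum_mulVec {f : ℕ → Matrix (Fin n) (Fin n) ℝ} {S : Matrix (Fin n) (Fin n) ℝ}
    (h : HasSum f S) (x : Fin n → ℝ) : HasSum (fun k => f k *ᵥ x) (S *ᵥ x) :=
  h.map (mulVec.addMonoidHomLeft x) (continuous_id.matrix_mulVec continuous_const)

theorem hasSum_mulVec_apply {f : ℕ → Matrix (Fin n) (Fin n) ℝ} {S : Matrix (Fin n) (Fin n) ℝ}
    (h : HasSum f S) (x : Fin n → ℝ) (i : Fin n) :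
    HasSum (fun k => (f k *ᵥ x) i) ((S *ᵥ x) i) :=
  Pi.hasSum.1 (hasSum_mulVec h x) i

end Entrywise

/-! ### Consequences of irreducibility -/

section Irreducible

variable {n : ℕ}

/-- A left fixed vector of an irreducible stochastic matrix with entries of sum zero vanishes. -/
theorem eq_zero_of_vecMul_eq {S : Matrix (Fin n) (Fin n) ℝ} (hS : S ∈ rowStochastic ℝ (Fin n))
    (hI : S.IsIrreducible) {u : Fin n → ℝ} (hu : u ᵥ* S = u) (h0 : u ⬝ᵥ 1 = 0) : u = 0 := by
  simp only [dotProduct, Pi.one_apply, mul_one] at h0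
  have hp : (|u| + u) ᵥ* S = |u| + u := by rw [add_vecMul, abs_vecMul_eq hS hu, hu]
  -- The fixed vector `|u| + u` is either zero or positive everywhere; the latter would make `u`
  -- positive, against its zero sum.
  have hnp : ∀ i, u i ≤ 0 := by
    by_cases h : |u| + u = 0
    · intro i
      have h1 : |u i| + u i = 0 := congrFun h i
      linarith [abs_nonneg (u i)]
    · exfalso
      have h2 := pos_of_vecMul_eq hI hp (fun i => by
        have := neg_abs_le (u i)
        change 0 ≤ |u i| + u i
        linarith) h
      have h3 : ∀ i, 0 < u i := by
        intro i
        have h4 : 0 < |u i| + u i := h2 i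
        by_contra h5
        rw [abs_of_nonpos (by linarith)] at h4
        linarith
      obtain ⟨j, -⟩ := Function.ne_iff.1 h
      have : 0 < ∑ i, u i := Finset.sum_pos (fun i _ => h3 i) ⟨j, Finset.mem_univ j⟩
      linarith
  have h5 := (Finset.sum_eq_zero_iff_of_nonpos fun i _ => hnp i).1 h0
  exact funext fun i => h5 i (Finset.mem_univ i)

/-- The Fredholm alternative for `1 - S`, with `S` irreducible and stochastic. -/
theorem exists_sub_mulVec_eq {S : Matrix (Fin n) (Fin n) ℝ} (hS : S ∈ rowStochastic ℝ (Fin n))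
    (hI : S.IsIrreducible) {v : Fin n → ℝ} (hv : IsPerronVector S v) {b : Fin n → ℝ}
    (hb : v ⬝ᵥ b = 0) : ∃ w, w - S *ᵥ w = b := by
  -- The rank-one term removes the kernel of `1 - S`. It does not affect the solution, since pairing
  -- with `v` below yields `v ⬝ᵥ w = 0`.
  have hunit : IsUnit (1 - S + vecMulVec 1 v) := by
    rw [isUnit_iff_isUnit_det, isUnit_iff_ne_zero]
    intro hdet
    obtain ⟨u, hu0, hu⟩ := exists_vecMul_eq_zero_iff.2 hdet
    rw [vecMul_add, vecMul_sub, vecMul_one, vecMul_vecMulVec] at hu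
    have h1 : u ⬝ᵥ 1 = 0 := by
      have h2 := congrArg (fun x => x ⬝ᵥ (1 : Fin n → ℝ)) hu
      simp only [add_dotProduct, sub_dotProduct, ← dotProduct_mulVec, smul_dotProduct] at h2
      rw [hS.2, hv.2.1] at h2
      simpa using h2
    rw [h1, zero_smul, add_zero, sub_eq_zero] at hu
    exact hu0 (eq_zero_of_vecMul_eq hS hI hu.symm h1)
  obtain ⟨w, hw⟩ := (mulVec_surjective_iff_isUnit.2 hunit) b
  rw [add_mulVec, sub_mulVec, one_mulVec, vecMulVec_mulVec] at hw
  have h3 : v ⬝ᵥ w = 0 := by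
    have h4 := congrArg (fun x => v ⬝ᵥ x) hw
    simp only [dotProduct_add, dotProduct_sub, dotProduct_mulVec, hv.1, hb, dotProduct_smul] at h4
    rw [sub_self, zero_add] at h4
    simpa [hv.2.1] using h4
  refine ⟨w, ?_⟩
  rw [h3] at hw
  simpa using hw

/-- A nonnegative matrix strictly below an irreducible stochastic one does not have the
eigenvalue one. -/
theorem isUnit_one_sub_of_le {S B : Matrix (Fin n) (Fin n) ℝ}
    (hS : S ∈ rowStochastic ℝ (Fin n)) (hI : S.IsIrreducible) (hB : ∀ i j, 0 ≤ B i j)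
    (hBS : ∀ i j, B i j ≤ S i j) (hne : B ≠ S) : IsUnit (1 - B) := by
  rw [isUnit_iff_isUnit_det, isUnit_iff_ne_zero]
  intro hdet
  obtain ⟨u, hu0, hu⟩ := exists_vecMul_eq_zero_iff.2 hdet
  rw [vecMul_sub, vecMul_one, sub_eq_zero] at hu
  have h1 : ∀ j, |u| j ≤ (|u| ᵥ* B) j := by
    intro j
    have h : u j = ∑ i, u i * B i j := congrFun hu j
    calc |u| j = |∑ i, u i * B i j| := by rw [← h]; rfl
      _ ≤ ∑ i, |u i * B i j| := Finset.abs_sum_le_sum_abs _ _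
      _ = ∑ i, |u| i * B i j :=
        Finset.sum_congr rfl fun i _ => by rw [abs_mul, abs_of_nonneg (hB i j)]; rfl
  have h2 : ∀ i j, |u| i * B i j ≤ |u| i * S i j := fun i j =>
    mul_le_mul_of_nonneg_left (hBS i j) (abs_nonneg (u i))
  have h3 : ∀ j, (|u| ᵥ* B) j ≤ (|u| ᵥ* S) j := fun j =>
    Finset.sum_le_sum (s := Finset.univ) fun i _ => h2 i j
  have hsum : ∑ j, |u| j = ∑ j, (|u| ᵥ* S) j := by
    have h : (|u| ᵥ* S) ⬝ᵥ 1 = |u| ⬝ᵥ 1 := by rw [← dotProduct_mulVec, hS.2]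
    simpa [dotProduct] using h.symm
  -- `S` preserves total mass, so `|u| ≤ |u| B ≤ |u| S` is a chain of equalities.
  have h4 : ∀ j, |u| j = (|u| ᵥ* S) j := fun j =>
    (Finset.sum_eq_sum_iff_of_le fun j _ => (h1 j).trans (h3 j)).1 hsum j (Finset.mem_univ j)
  have h5 := pos_of_vecMul_eq hI (funext h4).symm (fun i => abs_nonneg (u i))
    (fun h => hu0 (funext fun i => abs_eq_zero.1 (congrFun h i)))
  apply hne
  ext i j
  have h6 : (|u| ᵥ* B) j = (|u| ᵥ* S) j := le_antisymm (h3 j) ((h4 j).symm.le.trans (h1 j))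
  have h7 := (Finset.sum_eq_sum_iff_of_le (s := Finset.univ) fun i _ => h2 i j).1 h6 i (Finset.mem_univ i)
  exact mul_left_cancel₀ (h5 i).ne' h7

/-- If `B` lies below a stochastic matrix with a positive left fixed vector, and `1 - B` is
invertible, then `1 - B` is inverse-positive. -/
theorem nonneg_of_one_sub_mulVec_nonneg {S B : Matrix (Fin n) (Fin n) ℝ} {v : Fin n → ℝ}
    (hv : IsPerronVector S v) (hB : ∀ i j, 0 ≤ B i j) (hBS : ∀ i j, B i j ≤ S i j)
    (hunit : IsUnit (1 - B)) {x : Fin n → ℝ} (hx : ∀ i, 0 ≤ ((1 - B) *ᵥ x) i) :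
    ∀ i, 0 ≤ x i := by
  -- The negative part satisfies `y ≤ B y ≤ S y`. Weighting by `v` forces equality, so `y` lies in
  -- the kernel of `1 - B`.
  set y : Fin n → ℝ := fun i => max (-x i) 0 with hy
  have hy0 : ∀ i, 0 ≤ y i := fun i => le_max_right _ _
  have hBy0 : ∀ i, 0 ≤ (B *ᵥ y) i := fun i =>
    Finset.sum_nonneg (s := Finset.univ) fun k _ => mul_nonneg (hB i k) (hy0 k)
  have h1 : ∀ i, y i ≤ (B *ᵥ y) i := by
    intro i
    refine max_le ?_ (hBy0 i)
    have h2 := mulVec_entry_mono hB (x := -x) (y := y) (fun i => le_max_left _ _) i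
    have h3 := hx i
    rw [sub_mulVec, one_mulVec] at h3
    rw [mulVec_neg] at h2
    simp only [Pi.sub_apply, Pi.neg_apply] at h2 h3
    linarith
  have h2 : ∀ i, (B *ᵥ y) i ≤ (S *ᵥ y) i := fun i =>
    Finset.sum_le_sum (s := Finset.univ) fun k _ =>
      mul_le_mul_of_nonneg_right (hBS i k) (hy0 k)
  have hsum : ∑ i, v i * y i = ∑ i, v i * (S *ᵥ y) i := by
    have h : v ⬝ᵥ (S *ᵥ y) = v ⬝ᵥ y := by rw [dotProduct_mulVec, hv.1]
    exact h.symm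
  have h3 := (Finset.sum_eq_sum_iff_of_le fun i _ =>
    mul_le_mul_of_nonneg_left ((h1 i).trans (h2 i)) (hv.2.2 i).le).1 hsum
  have h4 : (1 - B) *ᵥ y = 0 := by
    rw [sub_mulVec, one_mulVec, sub_eq_zero]
    ext i
    have h5 := mul_left_cancel₀ (hv.2.2 i).ne' (h3 i (Finset.mem_univ i))
    exact le_antisymm (h1 i) ((h2 i).trans h5.symm.le)
  have h5 : y = 0 := mulVec_injective_of_isUnit hunit (by rw [h4, mulVec_zero])
  intro i
  have h6 : -x i ≤ y i := le_max_left _ _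
  rw [h5] at h6
  simpa using h6

end Irreducible

/-! ### Power series with nonnegative matrix coefficients -/

section Series

variable {n : ℕ} {A : ℕ → Matrix (Fin n) (Fin n) ℝ}

theorem mul_entry_le_mulVec_one {B X : Matrix (Fin n) (Fin n) ℝ} (hB : ∀ i j, 0 ≤ B i j)
    (hX : IsRowSubstochastic X) (i j : Fin n) : (B * X) i j ≤ (B *ᵥ 1) i := by
  rw [mul_apply]
  exact Finset.sum_le_sum fun k _ => mul_le_mul_of_nonneg_left
    ((entry_le_mulVec_one hX.1 k j).trans (hX.2 k)) (hB i k)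

theorem summable_mul_pow (hnn : ∀ k i j, 0 ≤ A k i j) (hA : Summable A)
    {X : Matrix (Fin n) (Fin n) ℝ} (hX : IsRowSubstochastic X) :
    Summable fun k : ℕ => A k * X ^ k :=
  summable_of_entry fun i j =>
    Summable.of_nonneg_of_le (fun k => mul_entry_nonneg (hnn k) (hX.pow k).1 i j)
      (fun k => mul_entry_le_mulVec_one (hnn k) (hX.pow k) i j)
      (hasSum_mulVec_apply hA.hasSum 1 i).summable

/-- The map `X ↦ A_{-1} + A_0 X + A_1 X² + ⋯`. -/
noncomputable def seriesMap (A : ℕ → Matrix (Fin n) (Fin n) ℝ) (X : Matrix (Fin n) (Fin n) ℝ) :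
    Matrix (Fin n) (Fin n) ℝ :=
  ∑' k : ℕ, A k * X ^ k

theorem hasSum_seriesMap (hnn : ∀ k i j, 0 ≤ A k i j) (hA : Summable A)
    {X : Matrix (Fin n) (Fin n) ℝ} (hX : IsRowSubstochastic X) :
    HasSum (fun k : ℕ => A k * X ^ k) (seriesMap A X) :=
  (summable_mul_pow hnn hA hX).hasSum

/-- The offset `m` serves the full series and its tails. Convergence is a hypothesis so that `Y` may
be any nonnegative solution, not only a substochastic one. -/
theorem hasSum_mul_pow_mono (hnn : ∀ k i j, 0 ≤ A k i j) {X Y S T : Matrix (Fin n) (Fin n) ℝ}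
    (hX : ∀ i j, 0 ≤ X i j) (hXY : ∀ i j, X i j ≤ Y i j) {m : ℕ}
    (hS : HasSum (fun k : ℕ => A (k + m) * X ^ (k + m)) S)
    (hT : HasSum (fun k : ℕ => A (k + m) * Y ^ (k + m)) T) (i j : Fin n) : S i j ≤ T i j :=
  hasSum_le (fun _ => mul_entry_mono (hnn _) (fun _ _ => le_rfl) (pow_entry_nonneg hX _)
    (pow_entry_mono hX hXY _) i j) (hasSum_entry hS i j) (hasSum_entry hT i j)

theorem hasSum_mul_pow_nonneg (hnn : ∀ k i j, 0 ≤ A k i j) {X S : Matrix (Fin n) (Fin n) ℝ}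
    (hX : ∀ i j, 0 ≤ X i j) {m : ℕ}
    (hS : HasSum (fun k : ℕ => A (k + m) * X ^ (k + m)) S) (i j : Fin n) : 0 ≤ S i j :=
  (hasSum_entry hS i j).nonneg fun _ => mul_entry_nonneg (hnn _) (pow_entry_nonneg hX _) i j

theorem seriesMap_mono (hnn : ∀ k i j, 0 ≤ A k i j) (hA : Summable A)
    {X Y : Matrix (Fin n) (Fin n) ℝ} (hX : IsRowSubstochastic X) (hY : IsRowSubstochastic Y)
    (hXY : ∀ i j, X i j ≤ Y i j) (i j : Fin n) : seriesMap A X i j ≤ seriesMap A Y i j :=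
  hasSum_mul_pow_mono (m := 0) hnn hX.1 hXY (hasSum_seriesMap hnn hA hX)
    (hasSum_seriesMap hnn hA hY) i j

theorem IsMG1.seriesMap_substochastic (hA : IsMG1 A) {X : Matrix (Fin n) (Fin n) ℝ}
    (hX : IsRowSubstochastic X) : IsRowSubstochastic (seriesMap A X) := by
  have hs := hasSum_seriesMap hA.nonneg hA.summable hX
  refine ⟨hasSum_mul_pow_nonneg (m := 0) hA.nonneg hX.1 hs, fun i => ?_⟩
  have h1 : (seriesMap A X *ᵥ 1) i ≤ ((∑' k, A k) *ᵥ 1) i := by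
    refine hasSum_le (fun k => ?_) (hasSum_mulVec_apply hs 1 i)
      (hasSum_mulVec_apply hA.summable.hasSum 1 i)
    rw [← mulVec_mulVec]
    exact mulVec_entry_mono (hA.nonneg k) (y := 1) (hX.pow k).2 i
  rwa [hA.stochastic.2] at h1

/-- Dominated convergence: on substochastic matrices the entries of the `k`-th term are bounded by
those of `A k *ᵥ 1`, which are summable. -/
theorem tendsto_seriesMap (hnn : ∀ k i j, 0 ≤ A k i j) (hA : Summable A)
    {T : ℕ → Matrix (Fin n) (Fin n) ℝ} {G : Matrix (Fin n) (Fin n) ℝ}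
    (hT : ∀ m, IsRowSubstochastic (T m)) (hG : Tendsto T atTop (𝓝 G)) :
    Tendsto (fun m => seriesMap A (T m)) atTop (𝓝 (seriesMap A G)) := by
  have hGs : IsRowSubstochastic G := by
    refine ⟨fun i j => ?_, fun i => ?_⟩
    · exact ge_of_tendsto' (tendsto_pi_nhds.1 (tendsto_pi_nhds.1 hG i) j) fun m => (hT m).1 i j
    · have h : Tendsto (fun m => T m *ᵥ (1 : Fin n → ℝ)) atTop (𝓝 (G *ᵥ 1)) :=
        ((continuous_id.matrix_mulVec continuous_const).tendsto G).comp hG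
      exact le_of_tendsto' (tendsto_pi_nhds.1 h i) fun m => (hT m).2 i
  refine tendsto_pi_nhds.2 fun i => tendsto_pi_nhds.2 fun j => ?_
  have key := tendsto_tsum_of_dominated_convergence (𝓕 := atTop)
    (f := fun m k => (A k * T m ^ k) i j) (g := fun k => (A k * G ^ k) i j)
    (hasSum_mulVec_apply hA.hasSum 1 i).summable
    (fun k => by
      have hc : Continuous fun X : Matrix (Fin n) (Fin n) ℝ => (A k * X ^ k) i j := by fun_prop
      exact (hc.tendsto G).comp hG)
    (Eventually.of_forall fun m k => by
      rw [Real.norm_of_nonneg (mul_entry_nonneg (hnn k) ((hT m).pow k).1 i j)]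
      exact mul_entry_le_mulVec_one (hnn k) ((hT m).pow k) i j)
  rw [(hasSum_entry (hasSum_seriesMap hnn hA hGs) i j).tsum_eq] at key
  simpa only [(hasSum_entry (hasSum_seriesMap hnn hA (hT _)) i j).tsum_eq] using key

end Series

/-! ### The natural iteration and the minimal solution -/

section Minimal

variable {n : ℕ} {A : ℕ → Matrix (Fin n) (Fin n) ℝ}

/-- The iteration `T ↦ A_{-1} + A_0 T + A_1 T² + ⋯` started from zero. -/
noncomputable def naturalIter (A : ℕ → Matrix (Fin n) (Fin n) ℝ) (m : ℕ) :
    Matrix (Fin n) (Fin n) ℝ :=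
  (seriesMap A)^[m] 0

theorem naturalIter_succ (A : ℕ → Matrix (Fin n) (Fin n) ℝ) (m : ℕ) :
    naturalIter A (m + 1) = seriesMap A (naturalIter A m) :=
  Function.iterate_succ_apply' _ _ _

theorem IsMG1.naturalIter_substochastic (hA : IsMG1 A) (m : ℕ) :
    IsRowSubstochastic (naturalIter A m) := by
  induction m with
  | zero => exact ⟨fun i j => le_rfl, fun i => by simp [naturalIter]⟩
  | succ m ih => rw [naturalIter_succ]; exact hA.seriesMap_substochastic ih

theorem IsMG1.naturalIter_le_succ (hA : IsMG1 A) (m : ℕ) :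
    ∀ i j, naturalIter A m i j ≤ naturalIter A (m + 1) i j := by
  induction m with
  | zero => exact (hA.naturalIter_substochastic 1).1
  | succ m ih =>
    rw [naturalIter_succ A (m + 1), naturalIter_succ A m]
    exact seriesMap_mono hA.nonneg hA.summable (hA.naturalIter_substochastic m)
      (naturalIter_succ A m ▸ hA.naturalIter_substochastic (m + 1))
      (by rw [← naturalIter_succ]; exact ih)

theorem IsMG1.naturalIter_le_solution (hA : IsMG1 A) {Z : Matrix (Fin n) (Fin n) ℝ}
    (hZ : IsNonnegSolution A Z) (m : ℕ) : ∀ i j, naturalIter A m i j ≤ Z i j := by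
  induction m with
  | zero => exact hZ.1
  | succ m ih =>
    have hm := hA.naturalIter_substochastic m
    rw [naturalIter_succ]
    exact hasSum_mul_pow_mono (m := 0) hA.nonneg hm.1 ih
      (hasSum_seriesMap hA.nonneg hA.summable hm) hZ.2

theorem IsMG1.exists_tendsto_naturalIter (hA : IsMG1 A) :
    ∃ G, IsMinimalNonnegSolution A G ∧ IsRowSubstochastic G ∧
      Tendsto (naturalIter A) atTop (𝓝 G) := by
  have hsub := hA.naturalIter_substochastic
  have hconv : ∀ i j, ∃ g, Tendsto (fun m => naturalIter A m i j) atTop (𝓝 g) := fun i j =>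
    ⟨_, tendsto_atTop_ciSup (monotone_nat_of_le_succ fun m => hA.naturalIter_le_succ m i j)
      ⟨1, by
        rintro _ ⟨m, rfl⟩
        exact (entry_le_mulVec_one (hsub m).1 i j).trans ((hsub m).2 i)⟩⟩
  choose G hG using hconv
  have hlim : Tendsto (naturalIter A) atTop (𝓝 (Matrix.of G)) :=
    tendsto_pi_nhds.2 fun i => tendsto_pi_nhds.2 fun j => hG i j
  have hfix : seriesMap A (Matrix.of G) = Matrix.of G := by
    have h1 := tendsto_seriesMap hA.nonneg hA.summable hsub hlim
    have h2 := hlim.comp (tendsto_add_atTop_nat 1)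
    refine tendsto_nhds_unique h1 (h2.congr fun m => ?_)
    exact naturalIter_succ A m
  have hGs : IsRowSubstochastic (Matrix.of G) := by
    refine ⟨fun i j => ge_of_tendsto' (hG i j) fun m => (hsub m).1 i j, fun i => ?_⟩
    have h : Tendsto (fun m => naturalIter A m *ᵥ (1 : Fin n → ℝ)) atTop
        (𝓝 (Matrix.of G *ᵥ 1)) :=
      ((continuous_id.matrix_mulVec continuous_const).tendsto _).comp hlim
    exact le_of_tendsto' (tendsto_pi_nhds.1 h i) fun m => (hsub m).2 i
  refine ⟨Matrix.of G, ⟨⟨hGs.1, ?_⟩, fun Z hZ i j => ?_⟩, hGs, hlim⟩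
  · have h := hasSum_seriesMap hA.nonneg hA.summable hGs
    rwa [hfix] at h
  · exact le_of_tendsto' (hG i j) fun m => hA.naturalIter_le_solution hZ m i j

end Minimal

/-! ### The minimal solution is stochastic -/

section Stochastic

variable {n : ℕ} {A : ℕ → Matrix (Fin n) (Fin n) ℝ}

/-- For `n = 0` the drift is an empty sum, hence not negative. -/
theorem DriftCondition.pos (h : DriftCondition A) : 0 < n := by
  rcases Nat.eq_zero_or_pos n with rfl | hn
  · exact absurd h.2 (by simp [drift])
  · exact hn

/-- The mean displacement minus `drift A • 1` is orthogonal to the Perron vector, so the Fredholm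
alternative applies. Adding a multiple of `1` to the solution preserves the equation and makes it
nonnegative. -/
theorem exists_lyapunov_vector (hA : IsMG1 A) (hD : DriftCondition A) :
    ∃ w : Fin n → ℝ, (∀ i, 0 ≤ w i) ∧
      ∀ i, ((∑' k : ℕ, ((k : ℝ) - 1) • A k) *ᵥ 1) i + ((∑' k, A k) *ᵥ w) i = w i + drift A := by
  have hv := isPerronVector_perronVector hD.pos hA.stochastic hA.irreducible
  set r : Fin n → ℝ := (∑' k : ℕ, ((k : ℝ) - 1) • A k) *ᵥ 1 with hr
  obtain ⟨w, hw⟩ := exists_sub_mulVec_eq hA.stochastic hA.irreducible hv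
    (b := r - drift A • 1) (by
      rw [dotProduct_sub, dotProduct_smul, hv.2.1, smul_eq_mul, mul_one]
      exact sub_self _)
  refine ⟨w + (∑ i, |w i|) • 1, fun i => ?_, fun i => ?_⟩
  · have h1 := Finset.single_le_sum (f := fun i => |w i|) (fun k _ => abs_nonneg (w k))
      (Finset.mem_univ i)
    have h2 := neg_abs_le (w i)
    simp only [Pi.add_apply, Pi.smul_apply, Pi.one_apply, smul_eq_mul, mul_one]
    linarith
  · have h1 := congrFun hw i
    rw [mulVec_add, mulVec_smul, hA.stochastic.2]
    simp only [Pi.add_apply, Pi.sub_apply, Pi.smul_apply, Pi.one_apply, smul_eq_mul,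
      mul_one] at h1 ⊢
    linarith

/-- The maximum principle for the hitting probabilities of the level process: the defect
`e - G^l e` is dominated by every positive multiple of the Lyapunov function `l e + w`. -/
theorem one_sub_pow_mulVec_le (hA : IsMG1 A) (hD : DriftCondition A)
    {G : Matrix (Fin n) (Fin n) ℝ} (hG : IsNonnegSolution A G) {w : Fin n → ℝ}
    (hw0 : ∀ i, 0 ≤ w i)
    (hw : ∀ i, ((∑' k : ℕ, ((k : ℝ) - 1) • A k) *ᵥ 1) i + ((∑' k, A k) *ᵥ w) i = w i + drift A)
    {ε : ℝ} (hε : 0 < ε) (m : ℕ) : ∀ (l : ℕ) (i : Fin n),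
      1 - (G ^ l *ᵥ 1) i - ε * (l + w i) ≤ max (1 + m * (ε * drift A)) 0 := by
  induction m with
  | zero =>
    intro l i
    refine le_max_of_le_left ?_
    have h1 : 0 ≤ (G ^ l *ᵥ 1) i := by
      simpa using mulVec_entry_mono (pow_entry_nonneg hG.1 l) (x := 0) (y := 1)
        (fun _ => zero_le_one) i
    have h2 : 0 ≤ ε * (l + w i) := mul_nonneg hε.le (add_nonneg l.cast_nonneg (hw0 i))
    simp only [Nat.cast_zero]
    linarith
  | succ m ih =>
    intro l i
    cases l with
    | zero =>
      refine le_max_of_le_right ?_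
      have := mul_nonneg hε.le (hw0 i)
      simpa using this
    | succ l =>
      set c := max (1 + m * (ε * drift A)) 0 with hc
      set g : ℕ → Fin n → ℝ := fun l i => 1 - (G ^ l *ᵥ 1) i - ε * (l + w i) with hg
      have hsA := hA.summable.hasSum
      have h1 : HasSum (fun k => (A k *ᵥ 1) i) 1 := by
        have h := hasSum_mulVec_apply hsA 1 i
        rwa [hA.stochastic.2] at h
      have h2 := hasSum_mulVec_apply (hG.2.mul_right (G ^ l)) 1 i
      have h3 := hasSum_mulVec_apply hD.1.hasSum 1 i
      have h4 := hasSum_mulVec_apply hsA w i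
      have h5 := ((h1.sub h2).sub (((h3.add (h1.mul_left ((l : ℝ) + 1))).add h4).mul_left ε))
      -- `A k` moves level `l + 1` to level `k + l`. Averaging `g` over one such step changes it by
      -- exactly `-ε * drift A`, so a bound `c` on all levels improves to `c + ε * drift A` at level
      -- `l + 1`; at level zero `g ≤ 0`.
      have h6 : HasSum (fun k => (A k *ᵥ g (k + l)) i) (g (l + 1) i - ε * drift A) := by
        have hgk : ∀ k, g (k + l) = 1 - G ^ (k + l) *ᵥ 1 - ε • (((k : ℝ) + l) • 1 + w) := by
          intro k
          funext j
          simp only [hg, Pi.sub_apply, Pi.add_apply, Pi.smul_apply, Pi.one_apply, smul_eq_mul]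
          push_cast
          ring
        have hval : g (l + 1) i - ε * drift A = 1 - ((G * G ^ l) *ᵥ 1) i -
            ε * (((∑' k : ℕ, ((k : ℝ) - 1) • A k) *ᵥ 1) i + ((l : ℝ) + 1) * 1 +
              ((∑' k, A k) *ᵥ w) i) := by
          rw [← pow_succ']
          simp only [hg]
          push_cast
          linear_combination ε * hw i
        rw [hval]
        refine h5.congr_fun fun k => ?_
        rw [hgk, mulVec_sub, mulVec_sub, mulVec_mulVec, mulVec_smul, mulVec_add, mulVec_smul,
          smul_mulVec, pow_add, ← mul_assoc]
        simp only [Pi.sub_apply, Pi.add_apply, Pi.smul_apply, smul_eq_mul]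
        ring
      have h7 : g (l + 1) i - ε * drift A ≤ c := by
        have h8 := h1.mul_right c
        rw [one_mul] at h8
        refine hasSum_le (fun k => ?_) h6 h8
        have h9 := mulVec_entry_mono (hA.nonneg k) (x := g (k + l)) (y := c • 1)
          (fun j => (ih (k + l) j).trans_eq (by simp)) i
        rwa [mulVec_smul, Pi.smul_apply, smul_eq_mul, mul_comm] at h9
      have h10 : ε * drift A < 0 := mul_neg_of_pos_of_neg hε hD.2
      change g (l + 1) i ≤ _
      rcases max_cases (1 + m * (ε * drift A)) 0 with h | h
      · refine le_max_of_le_left ?_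
        push_cast
        linarith [h.1]
      · refine le_max_of_le_right ?_
        linarith [h.1]

theorem IsNonnegSolution.mem_rowStochastic (hA : IsMG1 A) (hD : DriftCondition A)
    {G : Matrix (Fin n) (Fin n) ℝ} (hG : IsNonnegSolution A G) (hGs : IsRowSubstochastic G) :
    G ∈ rowStochastic ℝ (Fin n) := by
  obtain ⟨w, hw0, hw⟩ := exists_lyapunov_vector hA hD
  refine ⟨hG.1, funext fun i => le_antisymm (hGs.2 i) ?_⟩
  have h1 : ∀ ε : ℝ, 0 < ε → 1 - (G *ᵥ 1) i ≤ ε * (1 + w i) := by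
    intro ε hε
    have hd : 0 < -(ε * drift A) := neg_pos.2 (mul_neg_of_pos_of_neg hε hD.2)
    -- After this many steps `1 + m * (ε * drift A)` is negative and the bound is zero.
    obtain ⟨m, hm⟩ := exists_nat_gt (1 / -(ε * drift A))
    rw [div_lt_iff₀ hd] at hm
    have h := one_sub_pow_mulVec_le hA hD hG hw0 hw hε m 1 i
    rw [max_eq_right (by linarith), pow_one, Nat.cast_one] at h
    linarith
  have h2 : Tendsto (fun ε : ℝ => ε * (1 + w i)) (𝓝[>] 0) (𝓝 0) := by
    have h : Tendsto (fun ε : ℝ => ε * (1 + w i)) (𝓝 0) (𝓝 (0 * (1 + w i))) :=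
      tendsto_id.mul_const _
    rw [zero_mul] at h
    exact h.mono_left nhdsWithin_le_nhds
  have h3 : 1 - (G *ᵥ 1) i ≤ 0 :=
    ge_of_tendsto h2 (eventually_mem_nhdsWithin.mono fun ε hε => h1 ε hε)
  simpa using h3

end Stochastic

/-! ### The two-stage iteration -/

section Staircase

variable {n : ℕ} {A : ℕ → Matrix (Fin n) (Fin n) ℝ}

theorem IsMG1.le_tsum (hA : IsMG1 A) (k : ℕ) (i j : Fin n) : A k i j ≤ (∑' m, A m) i j :=
  le_hasSum (hasSum_entry hA.summable.hasSum i j) k fun m _ => hA.nonneg m i j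

/-- If `A 1` were the whole sum, every other coefficient would vanish; `A 1` carries weight zero, so
the drift would be zero. -/
theorem isUnit_one_sub (hA : IsMG1 A) (hD : DriftCondition A) : IsUnit (1 - A 1) := by
  refine isUnit_one_sub_of_le hA.stochastic hA.irreducible (hA.nonneg 1) (hA.le_tsum 1) ?_
  intro h
  have h0 : ∀ k, k ≠ 1 → A k = 0 := by
    intro k hk
    ext i j
    have h1 := sum_le_hasSum {1, k} (fun m _ => hA.nonneg m i j)
      (hasSum_entry hA.summable.hasSum i j)
    rw [Finset.sum_pair (Ne.symm hk), ← h] at h1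
    exact le_antisymm (by simpa using h1) (hA.nonneg k i j)
  have h1 : ∀ k : ℕ, ((k : ℝ) - 1) • A k = 0 := by
    intro k
    by_cases hk : k = 1
    · simp [hk]
    · rw [h0 k hk, smul_zero]
  have h2 := hD.2
  simp [drift, h1] at h2

/-- Inverse-positivity of `1 - A 1`, applied to each column of `Y - X`. -/
theorem entry_le_of_one_sub_mul (hA : IsMG1 A) (hD : DriftCondition A)
    {X Y : Matrix (Fin n) (Fin n) ℝ}
    (h : ∀ i j, ((1 - A 1) * X) i j ≤ ((1 - A 1) * Y) i j) (i j : Fin n) : X i j ≤ Y i j := by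
  have hv := isPerronVector_perronVector hD.pos hA.stochastic hA.irreducible
  have h1 := nonneg_of_one_sub_mulVec_nonneg hv (hA.nonneg 1) (hA.le_tsum 1)
    (isUnit_one_sub hA hD) (x := fun i => Y i j - X i j) (fun i => by
      have h2 := h i j
      rw [← sub_nonneg] at h2
      refine h2.trans_eq ?_
      simp only [mul_apply, mulVec, dotProduct, mul_sub, Finset.sum_sub_distrib]) i
  linarith

theorem hasSum_two (hA : IsMG1 A) {X : Matrix (Fin n) (Fin n) ℝ} (hX : IsRowSubstochastic X) :
    HasSum (fun k : ℕ => A (k + 2) * X ^ (k + 2)) (seriesMap A X - (A 0 + A 1 * X)) := by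
  have h := (hasSum_nat_add_iff' 2).2 (hasSum_seriesMap hA.nonneg hA.summable hX)
  simpa [Finset.sum_range_succ] using h

theorem hasSum_three (hA : IsMG1 A) {X : Matrix (Fin n) (Fin n) ℝ}
    (hX : IsRowSubstochastic X) : HasSum (fun k : ℕ => A (k + 3) * X ^ (k + 3))
      (seriesMap A X - (A 0 + A 1 * X + A 2 * X ^ 2)) := by
  have h := (hasSum_nat_add_iff' 3).2 (hasSum_seriesMap hA.nonneg hA.summable hX)
  simpa [Finset.sum_range_succ] using h

theorem seriesMap_mulVec_one (hA : IsMG1 A) {X : Matrix (Fin n) (Fin n) ℝ}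
    (hX : X ∈ rowStochastic ℝ (Fin n)) : seriesMap A X *ᵥ 1 = 1 := by
  have h1 := hasSum_mulVec
    (hasSum_seriesMap hA.nonneg hA.summable (isRowSubstochastic_of_mem hX)) 1
  have h2 := hasSum_mulVec hA.summable.hasSum 1
  rw [hA.stochastic.2] at h2
  refine h1.unique ?_
  convert h2 using 2 with k
  rw [← mulVec_mulVec, (pow_mem hX k).2]

theorem mem_rowStochastic_of_one_sub_mul (hA : IsMG1 A) (hD : DriftCondition A)
    {Y C : Matrix (Fin n) (Fin n) ℝ} (hC : ∀ i j, 0 ≤ C i j) (h : (1 - A 1) * Y = C)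
    (h1 : C *ᵥ 1 = 1 - A 1 *ᵥ 1) : Y ∈ rowStochastic ℝ (Fin n) := by
  refine ⟨fun i j => ?_, ?_⟩
  · refine entry_le_of_one_sub_mul hA hD (X := 0) (fun i j => ?_) i j
    rw [h, mul_zero]
    exact hC i j
  · refine mulVec_injective_of_isUnit (isUnit_one_sub hA hD) ?_
    rw [mulVec_mulVec, h, h1, sub_mulVec, one_mulVec]

variable {X Y : ℕ → Matrix (Fin n) (Fin n) ℝ}

theorem IsStaircaseIteration.first (hA : IsMG1 A) (h : IsStaircaseIteration A X Y) {k : ℕ}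
    (hX : IsRowSubstochastic (X k)) : (1 - A 1) * Y k = seriesMap A (X k) - A 1 * X k := by
  rw [(h k).1, (hasSum_two hA hX).tsum_eq]
  abel

theorem IsStaircaseIteration.second (hA : IsMG1 A) (hD : DriftCondition A)
    (h : IsStaircaseIteration A X Y) {k : ℕ} (hX : IsRowSubstochastic (X k)) :
    (1 - A 1) * X (k + 1) =
      A 0 + A 2 * Y k ^ 2 + (seriesMap A (X k) - (A 0 + A 1 * X k + A 2 * X k ^ 2)) := by
  have hu := (isUnit_iff_isUnit_det _).1 (isUnit_one_sub hA hD)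
  rw [(h k).2, mul_add, h.first hA hX, mul_assoc, mul_nonsing_inv_cancel_left _ _ hu, mul_sub]
  abel

theorem IsStaircaseIteration.mem_first (hA : IsMG1 A) (hD : DriftCondition A)
    (h : IsStaircaseIteration A X Y) {k : ℕ} (hX : X k ∈ rowStochastic ℝ (Fin n)) :
    Y k ∈ rowStochastic ℝ (Fin n) := by
  have hXs := isRowSubstochastic_of_mem hX
  refine mem_rowStochastic_of_one_sub_mul hA hD (fun i j => ?_) (h.first hA hXs) ?_
  · have h1 := hasSum_mul_pow_nonneg hA.nonneg hXs.1 (hasSum_two hA hXs) i j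
    have h2 := hA.nonneg 0 i j
    simp only [Matrix.sub_apply, Matrix.add_apply] at h1 ⊢
    linarith
  · rw [sub_mulVec, seriesMap_mulVec_one hA hX, ← mulVec_mulVec, hX.2]

theorem IsStaircaseIteration.mem_second (hA : IsMG1 A) (hD : DriftCondition A)
    (h : IsStaircaseIteration A X Y) {k : ℕ} (hX : X k ∈ rowStochastic ℝ (Fin n)) :
    X (k + 1) ∈ rowStochastic ℝ (Fin n) := by
  have hXs := isRowSubstochastic_of_mem hX
  have hY := h.mem_first hA hD hX
  refine mem_rowStochastic_of_one_sub_mul hA hD (fun i j => ?_) (h.second hA hD hXs) ?_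
  · have h1 := hasSum_mul_pow_nonneg hA.nonneg hXs.1 (hasSum_three hA hXs) i j
    have h2 := mul_entry_nonneg (hA.nonneg 2) (pow_entry_nonneg hY.1 2) i j
    rw [Matrix.add_apply, Matrix.add_apply]
    exact add_nonneg (add_nonneg (hA.nonneg 0 i j) h2) h1
  · simp only [add_mulVec, sub_mulVec]
    rw [seriesMap_mulVec_one hA hX]
    simp only [← mulVec_mulVec]
    rw [(pow_mem hX 2).2, (pow_mem hY 2).2, hX.2]
    abel

theorem IsStaircaseIteration.mem (hA : IsMG1 A) (hD : DriftCondition A)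
    (h : IsStaircaseIteration A X Y) (h0 : X 0 ∈ rowStochastic ℝ (Fin n)) (k : ℕ) :
    X k ∈ rowStochastic ℝ (Fin n) := by
  induction k with
  | zero => exact h0
  | succ k ih => exact h.mem_second hA hD ih

/-- Monotonicity of the natural iteration allows `A 1 * T_m` to be replaced by `A 1 * T_{m+1}`,
which puts it in the implicit form of the two-stage scheme. -/
theorem one_sub_mul_naturalIter_le (hA : IsMG1 A) (m : ℕ) (i j : Fin n) :
    ((1 - A 1) * naturalIter A (m + 1)) i j ≤
      (seriesMap A (naturalIter A m) - A 1 * naturalIter A m) i j := by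
  have h1 := mul_entry_mono (hA.nonneg 1) (fun _ _ => le_rfl)
    (hA.naturalIter_substochastic m).1 (hA.naturalIter_le_succ m) i j
  rw [sub_mul, one_mul, Matrix.sub_apply, Matrix.sub_apply]
  nth_rw 1 [naturalIter_succ]
  linarith

theorem IsStaircaseIteration.naturalIter_le (hA : IsMG1 A) (hD : DriftCondition A)
    (h : IsStaircaseIteration A X Y) (h0 : X 0 ∈ rowStochastic ℝ (Fin n)) (k : ℕ) :
    ∀ i j, naturalIter A k i j ≤ X k i j := by
  induction k with
  | zero => exact h0.1
  | succ k ih =>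
    have hXs := isRowSubstochastic_of_mem (h.mem hA hD h0 k)
    have hT := hA.naturalIter_substochastic k
    have hTY : ∀ i j, naturalIter A (k + 1) i j ≤ Y k i j := by
      refine entry_le_of_one_sub_mul hA hD fun i j => ?_
      refine (one_sub_mul_naturalIter_le hA k i j).trans ?_
      rw [h.first hA hXs]
      have h2 := hasSum_mul_pow_mono hA.nonneg hT.1 ih (hasSum_two hA hT) (hasSum_two hA hXs) i j
      simp only [Matrix.sub_apply, Matrix.add_apply] at h2 ⊢
      linarith
    refine entry_le_of_one_sub_mul hA hD fun i j => ?_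
    refine (one_sub_mul_naturalIter_le hA k i j).trans ?_
    rw [h.second hA hD hXs]
    have h2 := hasSum_mul_pow_mono hA.nonneg hT.1 ih (hasSum_three hA hT)
      (hasSum_three hA hXs) i j
    -- The quadratic terms compare through `T_k ≤ T_{k+1} ≤ Y_k`.
    have h3 := mul_entry_mono (hA.nonneg 2) (fun _ _ => le_rfl) (pow_entry_nonneg hT.1 2)
      (pow_entry_mono hT.1 (fun i j => (hA.naturalIter_le_succ k i j).trans (hTY i j)) 2) i j
    simp only [Matrix.sub_apply, Matrix.add_apply] at h2 ⊢
    linarith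

/-- Stochastic matrices dominating a sequence with a stochastic limit have the same limit. -/
theorem tendsto_of_le_of_rowStochastic {T : ℕ → Matrix (Fin n) (Fin n) ℝ}
    {G : Matrix (Fin n) (Fin n) ℝ} (hT : Tendsto T atTop (𝓝 G))
    (hG : G ∈ rowStochastic ℝ (Fin n)) (hX : ∀ k, X k ∈ rowStochastic ℝ (Fin n))
    (hTX : ∀ k i j, T k i j ≤ X k i j) : Tendsto X atTop (𝓝 G) := by
  refine tendsto_pi_nhds.2 fun i => tendsto_pi_nhds.2 fun j => ?_
  have h1 : Tendsto (fun k => T k i j) atTop (𝓝 (G i j)) :=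
    tendsto_pi_nhds.1 (tendsto_pi_nhds.1 hT i) j
  have h2 : Tendsto (fun k => (T k *ᵥ (1 : Fin n → ℝ)) i) atTop (𝓝 1) := by
    have h : Tendsto (fun k => T k *ᵥ (1 : Fin n → ℝ)) atTop (𝓝 (G *ᵥ 1)) :=
      ((continuous_id.matrix_mulVec continuous_const).tendsto G).comp hT
    rw [hG.2] at h
    exact tendsto_pi_nhds.1 h i
  have h3 : Tendsto (fun k => T k i j + (1 - (T k *ᵥ (1 : Fin n → ℝ)) i)) atTop
      (𝓝 (G i j)) := by
    simpa using h1.add (h2.const_sub 1)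
  refine tendsto_of_tendsto_of_tendsto_of_le_of_le h1 h3 (fun k => hTX k i j) fun k => ?_
  -- An entry of `X k - T k` is at most its row sum, which is the row defect of `T k`.
  have h4 := entry_le_mulVec_one (X := X k - T k) (fun a b => sub_nonneg.2 (hTX k a b)) i j
  rw [sub_mulVec, (hX k).2] at h4
  simp only [Matrix.sub_apply, Pi.sub_apply, Pi.one_apply] at h4
  linarith

end Staircase

theorem proposition2 {n : ℕ} (A : ℕ → Matrix (Fin n) (Fin n) ℝ) (hA : IsMG1 A)
    (hA1 : DriftCondition A) :
    -- the iteration is well defined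
    IsUnit (1 - A 1) ∧
    ∃ G : Matrix (Fin n) (Fin n) ℝ, IsMinimalNonnegSolution A G ∧
      ∀ X Y : ℕ → Matrix (Fin n) (Fin n) ℝ,
        X 0 ∈ rowStochastic ℝ (Fin n) → IsStaircaseIteration A X Y →
          (∀ k, Summable (fun i : ℕ => A (i + 2) * X k ^ (i + 2))) ∧
          (∀ k, X k ∈ rowStochastic ℝ (Fin n) ∧ Y k ∈ rowStochastic ℝ (Fin n)) ∧
          Tendsto X atTop (𝓝 G) := by
  refine ⟨isUnit_one_sub hA hA1, ?_⟩
  obtain ⟨G, hG, hGs, hlim⟩ := hA.exists_tendsto_naturalIter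
  refine ⟨G, hG, fun X Y h0 h => ?_⟩
  have hX := h.mem hA hA1 h0
  exact ⟨fun k => (hasSum_two hA (isRowSubstochastic_of_mem (hX k))).summable,
    fun k => ⟨hX k, h.mem_first hA hA1 (hX k)⟩,
    tendsto_of_le_of_rowStochastic hlim (hG.1.mem_rowStochastic hA hA1 hGs) hX
      (h.naturalIter_le hA hA1 h0)⟩
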